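/- Formulae in the continuous logic of C$^*$-algebras are built as follows. Terms are $*$-polynomials with complex coefficients in finitely many variables $x_1,\dots,x_n$ (built from the variables, the constant $0$, and, if one works with a unital C$^*$-algebra, the identity $I$, by addition, multiplication, multiplication by complex scalars and the adjoint). Atomic formulae are norms $\|t(x_1,\dots,x_n)\|$ of terms $t$. If $\varphi_1,\dots,\varphi_k$ are formulae and $f:\mathbb{R}^k\to\mathbb{R}$ is continuous, then $f(\varphi_1,\dots,\varphi_k)$ is a formula, and if $\varphi$ is a formula and $x$ a variable, then $\sup_{\|x\|\le 1}\varphi$ and $\inf_{\|x\|\le 1}\varphi$ are formulae, where $x$ ranges over the closed unit ball. A sentence is a formula $\varphi$ without free variables; its value in a C$^*$-algebra $\mathcal{A}$ is a real number $\varphi^{\mathcal{A}}$. A (not necessarily unital) C$^*$-algebra $\mathcal{A}$ is called pseudocompact if for every sentence $\varphi$ such that $\varphi^{\mathcal{F}}=0$ for all finite-dimensional C$^*$-algebras $\mathcal{F}$ (including the zero algebra), one has $\varphi^{\mathcal{A}}=0$; here the symbol $I$ may occur in $\varphi$ if $\mathcal{A}$ is unital. Proposition 5.2. If $\mathcal{A}$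 is a pseudocompact C$^*$-algebra and $p\in\mathcal{A}$ is a projection ($p=p^*=p^2$), then the corner $p\mathcal{A}p=\{pap : a\in\mathcal{A}\}$, with the operations and norm of $\mathcal{A}$, is a pseudocompact C$^*$-algebra. -/

import Mathlib

universe u

namespace PseudocompactCStar

/-- The C*-algebra `A` has a (two-sided) multiplicative identity. -/
def HasIdentity (A : Type u) [NonUnitalCStarAlgebra A] : Prop :=
  ∃ e : A, ∀ x : A, e * x = x ∧ x * e = x

open Classical in
/-- The identity element of `A` if there is one; the value `0` otherwise is never used in
`IsPseudocompact` below, since finite-dimensional C*-algebras are unital and the symbol for the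
identity is only available when `A` is unital. -/
noncomputable def identity (A : Type u) [NonUnitalCStarAlgebra A] : A :=
  if h : HasIdentity A then h.choose else 0

/-- The `*`-polynomials in `n` variables (terms of the language of C*-algebras). The constant
symbol for the identity belongs to the language only if `unital` holds. -/
inductive Term (unital : Prop) (n : ℕ) : Type
  | var (i : Fin n) : Term unital n
  | zero : Term unital n
  | one (h : unital) : Term unital n
  | add (s t : Term unital n) : Term unital n
  | mul (s t : Term unital n) : Term unital n
  | smul (c : ℂ) (t : Term unital n) : Term unital n
  | star (t : Term unital n) : Term unital n

/-- The formulae of the continuous logic of C*-algebras in `n` free variables: norms of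
`*`-polynomials, closed under finitary continuous connectives `ℝᵏ → ℝ` and under suprema and infima
over the closed unit ball (which bind the last variable). -/
inductive Formula (unital : Prop) : ℕ → Type
  | norm {n : ℕ} (t : Term unital n) : Formula unital n
  | connective {n k : ℕ} (f : C(Fin k → ℝ, ℝ)) (φ : Fin k → Formula unital n) : Formula unital n
  | sup {n : ℕ} (φ : Formula unital (n + 1)) : Formula unital n
  | inf {n : ℕ} (φ : Formula unital (n + 1)) : Formula unital n

/-- A sentence is a formula without free variables. -/
abbrev Sentence (unital : Prop) : Type := Formula unital 0

/-- The value of a `*`-polynomial at a tuple of elements of a C*-algebra. -/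
noncomputable def Term.eval {unital : Prop} {n : ℕ} (A : Type u) [NonUnitalCStarAlgebra A]
    (v : Fin n → A) : Term unital n → A
  | .var i => v i
  | .zero => 0
  | .one _ => identity A
  | .add s t => s.eval A v + t.eval A v
  | .mul s t => s.eval A v * t.eval A v
  | .smul c t => c • t.eval A v
  | .star t => Star.star (t.eval A v)

/-- The value of a formula at a tuple of elements of a C*-algebra. The suprema and infima are over
the non-empty closed unit ball, on which the values of a formula are bounded. -/
noncomputable def Formula.eval {unital : Prop} (A : Type u) [NonUnitalCStarAlgebra A] :
    {n : ℕ} → Formula unital n → (Fin n → A) → ℝ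
  | _, .norm t, v => ‖t.eval A v‖
  | _, .connective f φ, v => f (fun j => (φ j).eval A v)
  | n, .sup φ, v =>
      ⨆ x : {x : A // ‖x‖ ≤ 1}, φ.eval A (Fin.snoc (α := fun _ : Fin (n + 1) => A) v x.1)
  | n, .inf φ, v =>
      ⨅ x : {x : A // ‖x‖ ≤ 1}, φ.eval A (Fin.snoc (α := fun _ : Fin (n + 1) => A) v x.1)

/-- The value of a sentence in a C*-algebra. -/
noncomputable def Sentence.value {unital : Prop} (φ : Sentence unital) (A : Type u)
    [NonUnitalCStarAlgebra A] : ℝ :=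
  Formula.eval A φ Fin.elim0

/-- A C*-algebra `A` is pseudocompact if every sentence in the language of C*-algebras (with a
symbol for the identity if `A` is unital) that evaluates to zero in all finite-dimensional
C*-algebras evaluates to zero in `A`. (Every finite-dimensional C*-algebra has an isomorphic copy
in each universe.) -/
def IsPseudocompact (A : Type u) [NonUnitalCStarAlgebra A] : Prop :=
  ∀ φ : Sentence (HasIdentity A),
    (∀ (F : Type u) [NonUnitalCStarAlgebra F] [FiniteDimensional ℂ F], φ.value F = 0) →
      φ.value A = 0

/-- The corner `p A p = {p a p | a ∈ A}` for a projection `p`, as a `*`-subalgebra of `A`. -/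
def corner {A : Type u} [NonUnitalCStarAlgebra A] {p : A} (hp : IsStarProjection p) :
    NonUnitalStarSubalgebra ℂ A where
  carrier := {x | ∃ a : A, p * a * p = x}
  zero_mem' := ⟨0, by simp⟩
  add_mem' := by
    rintro _ _ ⟨a, rfl⟩ ⟨b, rfl⟩
    exact ⟨a + b, by simp only [mul_add, add_mul]⟩
  mul_mem' := by
    rintro _ _ ⟨a, rfl⟩ ⟨b, rfl⟩
    exact ⟨a * p * (p * b), by simp only [mul_assoc]⟩
  smul_mem' := by
    rintro c _ ⟨a, rfl⟩
    exact ⟨c • a, by simp only [mul_smul_comm, smul_mul_assoc]⟩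
  star_mem' := by
    rintro _ ⟨a, rfl⟩
    exact ⟨star a, by simp only [star_mul, hp.isSelfAdjoint.star_eq, mul_assoc]⟩

/-- A corner is norm closed, so it is a C*-algebra with the operations and norm of `A`. -/
instance corner_isClosed {A : Type u} [NonUnitalCStarAlgebra A] {p : A} (hp : IsStarProjection p) :
    IsClosed (corner hp : Set A) := by
  have hpp : p * p = p := hp.isIdempotentElem
  have h : (corner hp : Set A) = {x | p * x * p = x} := by
    ext x
    constructor
    · rintro ⟨a, rfl⟩
      change p * (p * a * p) * p = p * a * p
      rw [← mul_assoc, ← mul_assoc, hpp, mul_assoc, hpp]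
    · intro hx
      exact ⟨x, hx⟩
  rw [h]
  exact isClosed_eq (by fun_prop) continuous_id

end PseudocompactCStar

namespace PseudocompactCStar

/-! A sentence `φ` about `pAp` becomes a formula `φ'(x)` about `A`, evaluated at `x = p`: replace
each variable `y` by `x y x` and the identity by `x`. Since `a ↦ p a p` maps the unit ball of `A`
onto that of `pAp`, quantifiers stay as they are (`Formula.eval_relativize`).

If `φ` vanishes in all finite-dimensional algebras, then `φ'(q) = 0` for every projection `q` of a
finite-dimensional `F`, because `qFq` is finite-dimensional. Quantifiers range over the whole ball,
not over projections, so approximate projections must be handled: they are near true ones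
(`exists_isStarProjection_near`), and `φ'` has a modulus of continuity independent of the algebra
(`Formula.exists_modulus`). Hence `|φ'| ≤ ε` at all `δ`-approximate projections of all `F`. A single
sentence, the supremum of `testFormula`, expresses this; it passes to `A`, and `x = p` gives `|φ| ≤
ε` in `pAp`. -/

/-! ### Weak stability of projections -/

/-- An almost idempotent self-adjoint element is close to a projection. -/
theorem exists_isStarProjection_near_of_isSelfAdjoint {A : Type*} [NonUnitalCStarAlgebra A]
    {b : A} (hb : IsSelfAdjoint b) {δ : ℝ} (hδ : δ ≤ 1 / 8) (h : ‖b * b - b‖ ≤ δ) :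
    ∃ q : A, IsStarProjection q ∧ ‖q - b‖ ≤ 2 * δ := by
  have hspec : ∀ t ∈ quasispectrum ℝ b, |t * t - t| ≤ δ := by
    intro t ht
    have h1 : cfcₙ (fun t : ℝ => t * t - t) b = b * b - b := by
      rw [cfcₙ_sub (fun t : ℝ => t * t) (fun t => t) b, cfcₙ_mul (fun t : ℝ => t) (fun t => t) b,
        cfcₙ_id' ℝ b]
    have h2 := norm_apply_le_norm_cfcₙ (fun t : ℝ => t * t - t) b ht
    rw [h1, Real.norm_eq_abs] at h2
    exact h2.trans h
  -- The spectrum lies within `2δ ≤ 1/4` of `{0, 1}`, and `f` is `0` below `1/4` and `1` above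
  -- `3/4`.
  set f : ℝ → ℝ := fun t => min 1 (max 0 (2 * t - 1 / 2)) with hf
  have hfc : Continuous f := by fun_prop
  have hf0 : f 0 = 0 := by norm_num [hf]
  have key : ∀ t ∈ quasispectrum ℝ b, f t * f t = f t ∧ |f t - t| ≤ 2 * δ := by
    intro t ht
    have ht' := abs_le.1 (hspec t ht)
    rcases le_total t (1 / 2) with h2 | h2
    · have hup : t ≤ 2 * δ := by nlinarith
      have hlow : -(2 * δ) ≤ t := by nlinarith
      have : f t = 0 := by
        simp only [hf]
        rw [max_eq_left (by linarith)]
        norm_num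
      rw [this]
      exact ⟨by simp, abs_le.2 ⟨by linarith, by linarith⟩⟩
    · have hlow : 1 - 2 * δ ≤ t := by nlinarith
      have hup : t ≤ 1 + 2 * δ := by nlinarith
      have : f t = 1 := by
        simp only [hf]
        rw [max_eq_right (by linarith), min_eq_left (by linarith)]
      rw [this]
      exact ⟨by simp, abs_le.2 ⟨by linarith, by linarith⟩⟩
  refine ⟨cfcₙ f b, ⟨?_, cfcₙ_predicate f b⟩, ?_⟩
  · change cfcₙ f b * cfcₙ f b = cfcₙ f b
    rw [← cfcₙ_mul f f b]
    exact cfcₙ_congr fun t ht => (key t ht).1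
  · have h1 : cfcₙ f b - b = cfcₙ (fun t => f t - t) b := by
      rw [cfcₙ_sub f (fun t => t) b, cfcₙ_id' ℝ b]
    rw [h1]
    refine norm_cfcₙ_le fun t ht => ?_
    exact (key t ht).2

/-- Projections are weakly stable. -/
theorem exists_isStarProjection_near {A : Type*} [NonUnitalCStarAlgebra A] {a : A} (ha : ‖a‖ ≤ 1)
    {δ : ℝ} (hδ : δ ≤ 1 / 32) (h₁ : ‖star a - a‖ ≤ δ) (h₂ : ‖a * a - a‖ ≤ δ) :
    ∃ q : A, IsStarProjection q ∧ ‖q - a‖ ≤ 7 * δ := by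
  -- `a + c` is the real part of `a`.
  set c : A := (1 / 2 : ℝ) • (star a - a) with hc
  have hcn : ‖c‖ ≤ δ / 2 := by
    rw [hc, norm_smul]
    norm_num
    linarith
  have hb : IsSelfAdjoint (a + c) := by
    have h : a + c = (1 / 2 : ℝ) • (a + star a) := by
      rw [hc]
      module
    rw [h]
    exact (IsSelfAdjoint.all (1 / 2 : ℝ)).smul (IsSelfAdjoint.add_star_self a)
  have hδ0 : 0 ≤ δ := (norm_nonneg _).trans h₂
  have hbb : ‖(a + c) * (a + c) - (a + c)‖ ≤ 3 * δ := by
    have h : (a + c) * (a + c) - (a + c) = (a * a - a) + (a * c + c * a + c * c - c) := by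
      noncomm_ring
    have e1 : ‖a * c‖ ≤ δ / 2 := (norm_mul_le _ _).trans (by nlinarith [norm_nonneg c])
    have e2 : ‖c * a‖ ≤ δ / 2 := (norm_mul_le _ _).trans (by nlinarith [norm_nonneg c])
    have e3 : ‖c * c‖ ≤ δ / 2 := (norm_mul_le _ _).trans (by nlinarith [norm_nonneg c])
    rw [h]
    have n1 := norm_add_le (a * a - a) (a * c + c * a + c * c - c)
    have n2 := norm_sub_le (a * c + c * a + c * c) c
    have n3 := norm_add₃_le (a := a * c) (b := c * a) (c := c * c)
    linarith
  obtain ⟨q, hq, hqb⟩ := exists_isStarProjection_near_of_isSelfAdjoint hb (by linarith) hbb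
  refine ⟨q, hq, ?_⟩
  have h : q - a = (q - (a + c)) + c := by abel
  rw [h]
  have := norm_add_le (q - (a + c)) c
  linarith

/-! ### The identity symbol -/

theorem identity_mul {A : Type u} [NonUnitalCStarAlgebra A] (h : HasIdentity A) (x : A) :
    identity A * x = x ∧ x * identity A = x := by
  rw [identity, dif_pos h]
  exact h.choose_spec x

/-- The default value `0` is a projection too, so the constant has norm at most `1` in every
algebra. -/
theorem isStarProjection_identity (A : Type u) [NonUnitalCStarAlgebra A] :
    IsStarProjection (identity A) := by
  by_cases h : HasIdentity A
  · have h1 : star (identity A) = identity A := by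
      have e := congrArg star (identity_mul h (star (identity A))).1
      rw [star_mul, star_star] at e
      exact ((identity_mul h (star (identity A))).1.symm.trans (by simpa using e))
    exact ⟨(identity_mul h _).1, h1⟩
  · rw [identity, dif_neg h]
    exact IsStarProjection.zero A

/-- The corner is unital even if `A` is not, so its identity symbol must be translated by `p`. -/
theorem identity_corner {A : Type u} [NonUnitalCStarAlgebra A] {p : A} (hp : IsStarProjection p) :
    ((identity (corner hp) : corner hp) : A) = p := by
  have hpp : p * p = p := hp.isIdempotentElem
  have hmul : ∀ x : corner hp, p * (x : A) = x ∧ (x : A) * p = x := by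
    rintro ⟨_, a, rfl⟩
    exact ⟨by simp only [← mul_assoc, hpp], by simp only [mul_assoc, hpp]⟩
  let e : corner hp := ⟨p, p, by rw [hpp, hpp]⟩
  have h : HasIdentity (corner hp) :=
    ⟨e, fun x => ⟨Subtype.ext (hmul x).1, Subtype.ext (hmul x).2⟩⟩
  have h1 : ((identity (corner hp) * e : corner hp) : A) = p :=
    congrArg Subtype.val (identity_mul h e).1
  exact (hmul (identity (corner hp))).2.symm.trans h1

/-! ### Bounds and moduli uniform over all algebras -/

/-- Terms are bounded on the unit ball, uniformly over all C*-algebras. -/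
theorem Term.exists_norm_eval_le {unital : Prop} {n : ℕ} (t : Term unital n) :
    ∃ M : ℝ, 0 ≤ M ∧ ∀ (A : Type u) [NonUnitalCStarAlgebra A] (v : Fin n → A),
      (∀ i, ‖v i‖ ≤ 1) → ‖t.eval A v‖ ≤ M := by
  induction t with
  | var i => exact ⟨1, zero_le_one, fun A _ v hv => hv i⟩
  | zero => exact ⟨0, le_rfl, fun A _ v hv => by simp [Term.eval]⟩
  | one h => exact ⟨1, zero_le_one, fun A _ v hv => (isStarProjection_identity A).norm_le⟩
  | add s t hs ht =>
    obtain ⟨M, hM, hs⟩ := hs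
    obtain ⟨N, hN, ht⟩ := ht
    exact ⟨M + N, by positivity, fun A _ v hv => norm_add_le_of_le (hs A v hv) (ht A v hv)⟩
  | mul s t hs ht =>
    obtain ⟨M, hM, hs⟩ := hs
    obtain ⟨N, hN, ht⟩ := ht
    exact ⟨M * N, by positivity, fun A _ v hv => norm_mul_le_of_le (hs A v hv) (ht A v hv)⟩
  | smul c t ht =>
    obtain ⟨N, hN, ht⟩ := ht
    refine ⟨‖c‖ * N, by positivity, fun A _ v hv => ?_⟩
    rw [Term.eval, norm_smul]
    exact mul_le_mul_of_nonneg_left (ht A v hv) (norm_nonneg c)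
  | star t ht =>
    obtain ⟨N, hN, ht⟩ := ht
    refine ⟨N, hN, fun A _ v hv => ?_⟩
    rw [Term.eval, norm_star]
    exact ht A v hv

/-- Terms are Lipschitz on the unit ball, uniformly over all C*-algebras. -/
theorem Term.exists_norm_eval_sub_le {unital : Prop} {n : ℕ} (t : Term unital n) :
    ∃ L : ℝ, 0 ≤ L ∧ ∀ (A : Type u) [NonUnitalCStarAlgebra A] (v w : Fin n → A) (d : ℝ), 0 ≤ d →
      (∀ i, ‖v i‖ ≤ 1) → (∀ i, ‖w i‖ ≤ 1) → (∀ i, ‖v i - w i‖ ≤ d) →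
        ‖t.eval A v - t.eval A w‖ ≤ L * d := by
  induction t with
  | var i => exact ⟨1, zero_le_one, fun A _ v w d _ _ _ h => by simpa [Term.eval] using h i⟩
  | zero => exact ⟨0, le_rfl, fun A _ v w d _ _ _ h => by simp [Term.eval]⟩
  | one h => exact ⟨0, le_rfl, fun A _ v w d _ _ _ h => by simp [Term.eval]⟩
  | add s t hs ht =>
    obtain ⟨M, hM, hs⟩ := hs
    obtain ⟨N, hN, ht⟩ := ht
    refine ⟨M + N, by positivity, fun A _ v w d hd hv hw h => ?_⟩
    simp only [Term.eval]
    rw [add_sub_add_comm, add_mul]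
    exact norm_add_le_of_le (hs A v w d hd hv hw h) (ht A v w d hd hv hw h)
  | mul s t hs ht =>
    obtain ⟨M, hM, hs⟩ := hs
    obtain ⟨N, hN, ht⟩ := ht
    obtain ⟨M', hM', hs'⟩ := s.exists_norm_eval_le
    obtain ⟨N', hN', ht'⟩ := t.exists_norm_eval_le
    refine ⟨M * N' + M' * N, by positivity, fun A _ v w d hd hv hw h => ?_⟩
    have e : s.eval A v * t.eval A v - s.eval A w * t.eval A w =
        (s.eval A v - s.eval A w) * t.eval A v + s.eval A w * (t.eval A v - t.eval A w) := by
      noncomm_ring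
    simp only [Term.eval]
    rw [e, add_mul, mul_right_comm, mul_assoc M']
    exact norm_add_le_of_le (norm_mul_le_of_le (hs A v w d hd hv hw h) (ht' A v hv))
      (norm_mul_le_of_le (hs' A w hw) (ht A v w d hd hv hw h))
  | smul c t ht =>
    obtain ⟨N, hN, ht⟩ := ht
    refine ⟨‖c‖ * N, by positivity, fun A _ v w d hd hv hw h => ?_⟩
    simp only [Term.eval]
    rw [← smul_sub, norm_smul, mul_assoc]
    exact mul_le_mul_of_nonneg_left (ht A v w d hd hv hw h) (norm_nonneg c)
  | star t ht =>
    obtain ⟨N, hN, ht⟩ := ht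
    refine ⟨N, hN, fun A _ v w d hd hv hw h => ?_⟩
    simp only [Term.eval]
    rw [← star_sub, norm_star]
    exact ht A v w d hd hv hw h

theorem norm_snoc_le_one {A : Type*} [NonUnitalCStarAlgebra A] {n : ℕ} {v : Fin n → A}
    (hv : ∀ i, ‖v i‖ ≤ 1) {x : A} (hx : ‖x‖ ≤ 1) (i : Fin (n + 1)) :
    ‖Fin.snoc (α := fun _ : Fin (n + 1) => A) v x i‖ ≤ 1 := by
  induction i using Fin.lastCases with
  | last => simpa using hx
  | cast i => simpa using hv i

theorem norm_snoc_sub_snoc_le {A : Type*} [NonUnitalCStarAlgebra A] {n : ℕ} {v w : Fin n → A}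
    {d : ℝ} (hd : 0 ≤ d) (h : ∀ i, ‖v i - w i‖ ≤ d) (x : A) (i : Fin (n + 1)) :
    ‖Fin.snoc (α := fun _ : Fin (n + 1) => A) v x i -
      Fin.snoc (α := fun _ : Fin (n + 1) => A) w x i‖ ≤ d := by
  induction i using Fin.lastCases with
  | last => simpa using hd
  | cast i => simpa using h i

instance nonempty_closedUnitBall (A : Type*) [NonUnitalCStarAlgebra A] :
    Nonempty {x : A // ‖x‖ ≤ 1} :=
  ⟨⟨0, by simp⟩⟩

/-- Formulae are bounded on the unit ball, uniformly over all C*-algebras. -/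
theorem Formula.exists_abs_eval_le {unital : Prop} {n : ℕ} (φ : Formula unital n) :
    ∃ M : ℝ, ∀ (A : Type u) [NonUnitalCStarAlgebra A] (v : Fin n → A),
      (∀ i, ‖v i‖ ≤ 1) → |φ.eval A v| ≤ M := by
  induction φ with
  | norm t =>
    obtain ⟨M, -, hM⟩ := t.exists_norm_eval_le
    exact ⟨M, fun A _ v hv => by simpa [Formula.eval] using hM A v hv⟩
  | @connective n k f φ ih =>
    choose M hM using ih
    have hK : IsCompact (Set.pi Set.univ fun j => Set.Icc (-M j) (M j)) :=
      isCompact_univ_pi fun j => isCompact_Icc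
    obtain ⟨C, hC⟩ := hK.exists_bound_of_continuousOn f.continuous.continuousOn
    exact ⟨C, fun A _ v hv => hC _ fun j _ => abs_le.1 (hM j A v hv)⟩
  | sup φ ih =>
    obtain ⟨M, hM⟩ := ih
    refine ⟨M, fun A _ v hv => ?_⟩
    have hx := fun x : {x : A // ‖x‖ ≤ 1} => abs_le.1 (hM A _ (norm_snoc_le_one hv x.2))
    rw [Formula.eval, abs_le]
    exact ⟨le_ciSup_of_le ⟨M, Set.forall_mem_range.2 fun x => (hx x).2⟩ ⟨0, by simp⟩ (hx _).1,
      ciSup_le fun x => (hx x).2⟩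
  | inf φ ih =>
    obtain ⟨M, hM⟩ := ih
    refine ⟨M, fun A _ v hv => ?_⟩
    have hx := fun x : {x : A // ‖x‖ ≤ 1} => abs_le.1 (hM A _ (norm_snoc_le_one hv x.2))
    rw [Formula.eval, abs_le]
    exact ⟨le_ciInf fun x => (hx x).1,
      ciInf_le_of_le ⟨-M, Set.forall_mem_range.2 fun x => (hx x).1⟩ ⟨0, by simp⟩ (hx _).2⟩

/-- Needed because an unbounded real supremum takes a default value. -/
theorem bddAbove_range_eval_snoc {unital : Prop} {n : ℕ} (φ : Formula unital (n + 1))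
    {A : Type u} [NonUnitalCStarAlgebra A] {v : Fin n → A} (hv : ∀ i, ‖v i‖ ≤ 1) :
    BddAbove (Set.range fun x : {x : A // ‖x‖ ≤ 1} =>
      φ.eval A (Fin.snoc (α := fun _ : Fin (n + 1) => A) v x.1)) := by
  obtain ⟨M, hM⟩ := φ.exists_abs_eval_le
  exact ⟨M, Set.forall_mem_range.2 fun x => (abs_le.1 (hM A _ (norm_snoc_le_one hv x.2))).2⟩

theorem bddBelow_range_eval_snoc {unital : Prop} {n : ℕ} (φ : Formula unital (n + 1))
    {A : Type u} [NonUnitalCStarAlgebra A] {v : Fin n → A} (hv : ∀ i, ‖v i‖ ≤ 1) :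
    BddBelow (Set.range fun x : {x : A // ‖x‖ ≤ 1} =>
      φ.eval A (Fin.snoc (α := fun _ : Fin (n + 1) => A) v x.1)) := by
  obtain ⟨M, hM⟩ := φ.exists_abs_eval_le
  exact ⟨-M, Set.forall_mem_range.2 fun x => (abs_le.1 (hM A _ (norm_snoc_le_one hv x.2))).1⟩

/-- Formulae are uniformly continuous on the unit ball, uniformly over all C*-algebras. -/
theorem Formula.exists_modulus {unital : Prop} {n : ℕ} (φ : Formula unital n) :
    ∀ ε : ℝ, 0 < ε → ∃ δ : ℝ, 0 < δ ∧
      ∀ (A : Type u) [NonUnitalCStarAlgebra A] (v w : Fin n → A),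
        (∀ i, ‖v i‖ ≤ 1) → (∀ i, ‖w i‖ ≤ 1) → (∀ i, ‖v i - w i‖ ≤ δ) →
          φ.eval A v ≤ φ.eval A w + ε := by
  induction φ with
  | norm t =>
    intro ε hε
    obtain ⟨L, hL, h⟩ := t.exists_norm_eval_sub_le
    have hL1 : 0 < L + 1 := by positivity
    refine ⟨ε / (L + 1), by positivity, fun A _ v w hv hw hvw => ?_⟩
    have h1 := h A v w _ (by positivity) hv hw hvw
    have h2 : L * (ε / (L + 1)) ≤ ε := by
      rw [mul_div_assoc', div_le_iff₀ hL1]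
      nlinarith
    have h3 := norm_sub_norm_le (t.eval A v) (t.eval A w)
    simp only [Formula.eval]
    linarith
  | @connective n k f φ ih =>
    intro ε hε
    choose M hM using fun j => (φ j).exists_abs_eval_le
    have hK : IsCompact (Set.pi Set.univ fun j => Set.Icc (-M j) (M j)) :=
      isCompact_univ_pi fun j => isCompact_Icc
    have huc := hK.uniformContinuousOn_of_continuous f.continuous.continuousOn
    obtain ⟨η, hη, huc⟩ := Metric.uniformContinuousOn_iff_le.1 huc ε hε
    choose δ hδ h using fun j => ih j η hη
    obtain ⟨d, hd, hdδ⟩ : ∃ d : ℝ, 0 < d ∧ ∀ j, d ≤ δ j := by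
      obtain ⟨d, hd, h⟩ := Pi.exists_forall_pos_add_lt (x := fun _ => (0 : ℝ)) hδ
      exact ⟨d, hd, fun j => by simpa using (h j).le⟩
    refine ⟨d, hd, fun A _ v w hv hw hvw => ?_⟩
    have hdist := huc (fun j => (φ j).eval A v) (fun j _ => abs_le.1 (hM j A v hv))
      (fun j => (φ j).eval A w) (fun j _ => abs_le.1 (hM j A w hw)) <| by
        refine (dist_pi_le_iff hη.le).2 fun j => ?_
        have h1 := h j A v w hv hw fun i => (hvw i).trans (hdδ j)
        have h2 := h j A w v hw hv fun i => by
          rw [norm_sub_rev]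
          exact (hvw i).trans (hdδ j)
        rw [Real.dist_eq, abs_le]
        exact ⟨by linarith, by linarith⟩
    rw [Real.dist_eq, abs_le] at hdist
    simp only [Formula.eval]
    linarith [hdist.2]
  | sup φ ih =>
    intro ε hε
    obtain ⟨δ, hδ, h⟩ := ih ε hε
    refine ⟨δ, hδ, fun A _ v w hv hw hvw => ciSup_le fun x => ?_⟩
    refine (h A _ _ (norm_snoc_le_one hv x.2) (norm_snoc_le_one hw x.2)
      (norm_snoc_sub_snoc_le hδ.le hvw x.1)).trans ?_
    exact add_le_add_left (le_ciSup (bddAbove_range_eval_snoc φ hw) x) ε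
  | inf φ ih =>
    intro ε hε
    obtain ⟨δ, hδ, h⟩ := ih ε hε
    refine ⟨δ, hδ, fun A _ v w hv hw hvw => ?_⟩
    rw [← sub_le_iff_le_add]
    refine le_ciInf fun x => ?_
    rw [sub_le_iff_le_add]
    exact (ciInf_le (bddBelow_range_eval_snoc φ hv) x).trans
      (h A _ _ (norm_snoc_le_one hv x.2) (norm_snoc_le_one hw x.2)
        (norm_snoc_sub_snoc_le hδ.le hvw x.1))

/-! ### Relativization to a corner -/

/-- The relativization of a term to the corner given by a new first variable. -/
def Term.relativize {unital : Prop} (unital' : Prop) {n : ℕ} :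
    Term unital n → Term unital' (n + 1)
  -- The projection comes first because quantifiers bind the last variable.
  | .var i => .mul (.mul (.var 0) (.var i.succ)) (.var 0)
  | .zero => .zero
  | .one _ => .var 0
  | .add s t => .add (s.relativize unital') (t.relativize unital')
  | .mul s t => .mul (s.relativize unital') (t.relativize unital')
  | .smul c t => .smul c (t.relativize unital')
  | .star t => .star (t.relativize unital')

/-- The relativization of a formula to the corner given by a new first variable. -/
def Formula.relativize {unital : Prop} (unital' : Prop) :
    {n : ℕ} → Formula unital n → Formula unital' (n + 1)
  | _, .norm t => .norm (t.relativize unital')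
  | _, .connective f φ => .connective f fun j => (φ j).relativize unital'
  | _, .sup φ => .sup (φ.relativize unital')
  | _, .inf φ => .inf (φ.relativize unital')

/-- The compression of an element to a corner. -/
def compress {A : Type u} [NonUnitalCStarAlgebra A] {p : A} (hp : IsStarProjection p) (a : A) :
    corner hp :=
  ⟨p * a * p, a, rfl⟩

theorem norm_compress_le {A : Type u} [NonUnitalCStarAlgebra A] {p : A} (hp : IsStarProjection p)
    (a : A) : ‖compress hp a‖ ≤ ‖a‖ := by
  have h := hp.norm_le
  calc ‖p * a * p‖ ≤ ‖p‖ * ‖a‖ * ‖p‖ :=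
        (norm_mul_le _ _).trans (mul_le_mul_of_nonneg_right (norm_mul_le _ _) (norm_nonneg _))
    _ ≤ 1 * ‖a‖ * 1 := by gcongr
    _ = ‖a‖ := by ring

theorem compress_coe {A : Type u} [NonUnitalCStarAlgebra A] {p : A} (hp : IsStarProjection p)
    (x : corner hp) : compress hp (x : A) = x := by
  have hpp : p * p = p := hp.isIdempotentElem
  obtain ⟨_, a, rfl⟩ := x
  refine Subtype.ext ?_
  change p * (p * a * p) * p = p * a * p
  rw [← mul_assoc, ← mul_assoc, hpp, mul_assoc, hpp]

/-- Compression as a map of closed unit balls. -/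
def compressBall {A : Type u} [NonUnitalCStarAlgebra A] {p : A} (hp : IsStarProjection p)
    (x : {x : A // ‖x‖ ≤ 1}) : {x : corner hp // ‖x‖ ≤ 1} :=
  ⟨compress hp x.1, (norm_compress_le hp x.1).trans x.2⟩

/-- Elements of the corner are their own compressions. -/
theorem compressBall_surjective {A : Type u} [NonUnitalCStarAlgebra A] {p : A}
    (hp : IsStarProjection p) : Function.Surjective (compressBall hp) :=
  fun y => ⟨⟨y.1, y.2⟩, Subtype.ext (compress_coe hp y.1)⟩

theorem Term.eval_relativize {unital unital' : Prop} {n : ℕ} (t : Term unital n) {A : Type u}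
    [NonUnitalCStarAlgebra A] {p : A} (hp : IsStarProjection p) (v : Fin n → A) :
    (t.relativize unital').eval A (Fin.cons p v : Fin (n + 1) → A) =
      (t.eval (corner hp) (fun i => compress hp (v i)) : corner hp) := by
  induction t with
  | var i => rfl
  | zero => rfl
  | one h => exact (identity_corner hp).symm
  | add s t hs ht => exact congrArg₂ (· + ·) hs ht
  | mul s t hs ht => exact congrArg₂ (· * ·) hs ht
  | smul c t ht => exact congrArg (c • ·) ht
  | star t ht => exact congrArg Star.star ht

theorem Formula.eval_relativize {unital unital' : Prop} {n : ℕ} (φ : Formula unital n) {A : Type u}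
    [NonUnitalCStarAlgebra A] {p : A} (hp : IsStarProjection p) (v : Fin n → A) :
    (φ.relativize unital').eval A (Fin.cons p v : Fin (n + 1) → A) =
      φ.eval (corner hp) (fun i => compress hp (v i)) := by
  have snoc_cons : ∀ {n : ℕ} (v : Fin n → A) (x : A),
      Fin.snoc (α := fun _ : Fin (n + 1 + 1) => A) (Fin.cons p v : Fin (n + 1) → A) x =
        (Fin.cons p (Fin.snoc (α := fun _ : Fin (n + 1) => A) v x) : Fin (n + 1 + 1) → A) :=
    fun v x => (Fin.cons_snoc_eq_snoc_cons (β := A) p v x).symm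
  have compress_snoc : ∀ {n : ℕ} (v : Fin n → A) (x : A),
      (fun i => compress hp (Fin.snoc (α := fun _ : Fin (n + 1) => A) v x i)) =
        Fin.snoc (α := fun _ : Fin (n + 1) => corner hp) (fun i => compress hp (v i))
          (compress hp x) :=
    fun v x => Fin.comp_snoc (compress hp) v x
  induction φ with
  | norm t => exact congrArg (fun a : A => ‖a‖) (t.eval_relativize hp v)
  | connective f φ ih => exact congrArg f (funext fun j => ih j v)
  | sup φ ih =>
    simp only [Formula.relativize, Formula.eval]
    rw [← (compressBall_surjective hp).iSup_comp]
    refine iSup_congr fun x => ?_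
    rw [snoc_cons, ih, compress_snoc]
    rfl
  | inf φ ih =>
    simp only [Formula.relativize, Formula.eval]
    rw [← (compressBall_surjective hp).iInf_comp]
    refine iInf_congr fun x => ?_
    rw [snoc_cons, ih, compress_snoc]
    rfl

/-! ### Transfer through a test sentence -/

/-- The connective `(a, b, c) ↦ min (δ ∸ (a + b)) (|c| ∸ ε)`. -/
def testConnective (δ ε : ℝ) : C(Fin 3 → ℝ, ℝ) where
  toFun y := min (max (δ - (y 0 + y 1)) 0) (max (|y 2| - ε) 0)
  continuous_toFun := by fun_prop

/-- The formula in one variable `x` that vanishes exactly if `x` is not `δ`-close to satisfying the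
relations of a projection or `|φ(x)| ≤ ε`. -/
def testFormula {unital : Prop} (δ ε : ℝ) (φ : Formula unital 1) : Formula unital 1 :=
  .connective (testConnective δ ε)
    ![.norm (.add (.star (.var 0)) (.smul (-1) (.var 0))),
      .norm (.add (.mul (.var 0) (.var 0)) (.smul (-1) (.var 0))), φ]

theorem eval_testFormula {unital : Prop} (δ ε : ℝ) (φ : Formula unital 1) {A : Type u}
    [NonUnitalCStarAlgebra A] (v : Fin 1 → A) :
    (testFormula δ ε φ).eval A v =
      min (max (δ - (‖star (v 0) - v 0‖ + ‖v 0 * v 0 - v 0‖)) 0) (max (|φ.eval A v| - ε) 0) := by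
  simp [testFormula, testConnective, Formula.eval, Term.eval, sub_eq_add_neg]

theorem abs_eval_relativize_le {unital unital' : Prop} (φ : Sentence unital)
    (hφ : ∀ (F : Type u) [NonUnitalCStarAlgebra F] [FiniteDimensional ℂ F], φ.value F = 0)
    {ε : ℝ} (hε : 0 < ε) :
    ∃ δ : ℝ, 0 < δ ∧ ∀ (F : Type u) [NonUnitalCStarAlgebra F] [FiniteDimensional ℂ F]
      (v : Fin 1 → F), ‖v 0‖ ≤ 1 → ‖star (v 0) - v 0‖ ≤ δ → ‖v 0 * v 0 - v 0‖ ≤ δ →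
        |(φ.relativize unital').eval F v| ≤ ε := by
  obtain ⟨d, hd, h⟩ := (φ.relativize unital').exists_modulus ε hε
  -- `1/32` is the stability threshold; `d/7` places the projection within `d`.
  refine ⟨min (1 / 32) (d / 7), by positivity, fun F _ _ v hv h1 h2 => ?_⟩
  obtain ⟨q, hq, hqv⟩ := exists_isStarProjection_near hv (min_le_left _ _) h1 h2
  have hdist : ‖q - v 0‖ ≤ d := by linarith [min_le_right (1 / 32) (d / 7)]
  have : FiniteDimensional ℂ (corner hq) :=
    inferInstanceAs (FiniteDimensional ℂ (corner hq).toSubmodule)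
  have hval : (φ.relativize unital').eval F (Fin.cons q Fin.elim0 : Fin 1 → F) = 0 := by
    rw [Formula.eval_relativize φ hq, ← hφ (corner hq), Sentence.value]
    congr 1
    exact Subsingleton.elim _ _
  have hq1 : ∀ i, ‖(Fin.cons q Fin.elim0 : Fin 1 → F) i‖ ≤ 1 :=
    Fin.forall_fin_one.2 hq.norm_le
  have hv1 : ∀ i, ‖v i‖ ≤ 1 := Fin.forall_fin_one.2 hv
  have e1 := h F v _ hv1 hq1 (Fin.forall_fin_one.2 (by rw [norm_sub_rev]; exact hdist))
  have e2 := h F _ v hq1 hv1 (Fin.forall_fin_one.2 hdist)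
  rw [abs_le]
  constructor <;> linarith

end PseudocompactCStar

open PseudocompactCStar in
theorem proposition5p2 {A : Type u} [NonUnitalCStarAlgebra A]
    (hA : PseudocompactCStar.IsPseudocompact A) {p : A} (hp : IsStarProjection p) :
    PseudocompactCStar.IsPseudocompact (PseudocompactCStar.corner hp) := by
  intro φ hφ
  rw [← abs_nonpos_iff]
  refine le_of_forall_pos_le_add fun ε hε => ?_
  rw [zero_add]
  obtain ⟨δ, hδ, hF⟩ := abs_eval_relativize_le (unital' := HasIdentity A) φ hφ hε
  have hsent := hA (.sup (testFormula δ ε (φ.relativize (HasIdentity A)))) fun F _ _ => by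
    refine (iSup_congr fun x => ?_).trans ciSup_const
    rw [eval_testFormula]
    set v := Fin.snoc (α := fun _ : Fin 1 => F) Fin.elim0 x.1
    have hv : ‖v 0‖ ≤ 1 := x.2
    -- Near projections the second entry of the minimum vanishes, elsewhere the first.
    by_cases h : ‖star (v 0) - v 0‖ + ‖v 0 * v 0 - v 0‖ ≤ δ
    · have := hF F v hv (by linarith [norm_nonneg (v 0 * v 0 - v 0)])
        (by linarith [norm_nonneg (star (v 0) - v 0)])
      rw [max_eq_right (by linarith : |(φ.relativize _).eval F v| - ε ≤ 0)]
      exact min_eq_right (le_max_right _ _)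
    · rw [max_eq_right (by linarith)]
      exact min_eq_left (le_max_right _ _)
  have hle := (le_ciSup (bddAbove_range_eval_snoc (testFormula δ ε (φ.relativize (HasIdentity A)))
    (v := (Fin.elim0 : Fin 0 → A)) (fun i => i.elim0)) ⟨p, hp.norm_le⟩).trans hsent.le
  have hv : Fin.snoc (α := fun _ : Fin 1 => A) Fin.elim0 p = (Fin.cons p Fin.elim0 : Fin 1 → A) :=
    funext (Fin.forall_fin_one.2 rfl)
  have hval : (φ.relativize (HasIdentity A)).eval A (Fin.cons p Fin.elim0 : Fin 1 → A) =
      φ.value (corner hp) := by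
    rw [Formula.eval_relativize φ hp, Sentence.value]
    congr 1
    exact Subsingleton.elim _ _
  rw [eval_testFormula, hv, hval, Fin.cons_zero, hp.isSelfAdjoint.star_eq,
    hp.isIdempotentElem.eq] at hle
  by_contra! hlt
  -- At the exact projection `p` the first entry is `δ`.
  have : 0 < min (max (δ - (‖p - p‖ + ‖p - p‖)) 0) (max (|φ.value (corner hp)| - ε) 0) :=
    lt_min (lt_max_of_lt_left (by simpa using hδ)) (lt_max_of_lt_left (by linarith))
  exact absurd hle this.not_ge
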